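/- **Setting.** Let $K$ be a field (e.g. $\mathbb{R}$, $\mathbb{C}$ or a field of rational functions) and consider a network with nodes $1,\dots,n$ ($n\ge 2$) and finitely many branches, each joining two distinct nodes and carrying an admittance in $K$ (parallel branches are allowed). Its admittance matrix $Y\in K^{n\times n}$ has $Y_{ii}$ equal to the sum of the admittances of all branches incident with node $i$, and $Y_{il}$, for $i\ne l$, equal to minus the sum of the admittances of all branches joining $i$ and $l$. For distinct nodes $j,k$, *contracting the network on $j$ and $k$* means deleting all branches that join $j$ and $k$ and identifying node $k$ with node $j$. The index $k$ is removed and all larger indices are lowered by one, so a node $p\ne k$ gets the new index $p'=p$ if $p<k$ and $p'=p-1$ if $p>k$; the merged node has index $j'$. Let $Y^-\in K^{(n-1)\times(n-1)}$ be the admittance matrix of the contracted network. For a square matrix $A$, the first cofactors are $C_{a,b}(A)=(-1)^{a+b}\det A_{(a,b)}$, with $A_{(a,b)}$ obtained by deleting row $a$ and column $b$. The second cofactors are $$C_{ab,cd}(A)=(-1)^{\sigma(a,b)+\sigma(c,d)}\det A_{(ab,cd)}\quad(a\ne b,\ c\ne d),$$ where $A_{(ab,cd)}$ is obtained by deleting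 rows $a,b$ and columns $c,d$, and $\sigma(a,b)=a+b-1$ if $a<b$, $\sigma(a,b)=a+b$ otherwise; $C_{ab,cd}(A)=0$ if $a=b$ or $c=d$. The determinant of the empty matrix is $1$. If all first cofactors of $A$ are equal, $c(A)$ denotes their common value, and, if $c(A)\neq 0$, the transfer impedances and self-impedances are $z_{ab,cd}(A)=C_{ab,cd}(A)/c(A)$ and $Z_{ab}(A)=z_{ab,ab}(A)$. **Proposition.** All first cofactors of $Y$ are equal. Suppose that their common value $c(Y)$ is nonzero (equivalently, $Y$ has rank $n-1$). Then for all distinct nodes $j,k$ and all nodes $p,q,r,s\neq k$, $$C_{p'q',r's'}(Y^-)=\frac{1}{c(Y)}\Bigl[C_{pq,rs}(Y)\,C_{jk,jk}(Y)-C_{pq,jk}(Y)\,C_{rs,jk}(Y)\Bigr].$$ If moreover $Z_{jk}(Y)\neq 0$, then all first cofactors of $Y^-$ are equal, $c(Y^-)\ne 0$, and for all $p,q,r,s\ne k$ $$z_{p'q',r's'}(Y^-)=z_{pq,rs}(Y)-z_{pq,jk}(Y)\,\frac{z_{rs,jk}(Y)}{Z_{jk}(Y)},\qquad Z_{p'q'}(Y^-)=Z_{pq}(Y)-\frac{z_{pq,jk}(Y)^2}{Z_{jk}(Y)}.$$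 -/

import Mathlib

/-- A linear electrical network with node set `V`, branch set `B` and scalar admittances in `K`.
Each branch is oriented from `src` to `tgt` and joins two distinct nodes; several branches may
join the same two nodes. -/
structure ElectricalNetwork (K V B : Type*) where
  src : B → V
  tgt : B → V
  adm : B → K
  src_ne_tgt : ∀ b, src b ≠ tgt b

namespace ElectricalNetwork

variable {K V B : Type*}

/-- Branch `b` is incident with node `i` (in either orientation). -/
abbrev Incident (N : ElectricalNetwork K V B) (b : B) (i : V) : Prop :=
  N.src b = i ∨ N.tgt b = i

/-- The endpoints of branch `b` are `i` and `l` (in either orientation). -/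
abbrev Joins (N : ElectricalNetwork K V B) (b : B) (i l : V) : Prop :=
  (N.src b = i ∧ N.tgt b = l) ∨ (N.src b = l ∧ N.tgt b = i)

/-- The (node-)admittance matrix: diagonal entries are the sums of the admittances of all branches
incident with the node, and the entry at `i ≠ l` is the negative of the sum of the admittances of
all branches whose endpoints are `i` and `l`. -/
def admittanceMatrix [Field K] [DecidableEq V] [Fintype B] (N : ElectricalNetwork K V B) :
    Matrix V V K :=
  Matrix.of fun i l =>
    if i = l then ∑ b with N.Incident b i, N.adm b
    else -∑ b with N.Joins b i l, N.adm b

end ElectricalNetwork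

/-- The index, once index `k` has been removed and the larger indices lowered by one, of a node
`i ≠ k`. -/
def indexAfterRemoving {n : ℕ} (k i : Fin (n + 1)) (hi : i ≠ k) : Fin n :=
  ⟨if k < i then (i : ℕ) - 1 else (i : ℕ), by
    have h1 := i.isLt
    have h2 := k.isLt
    have h3 : (i : ℕ) ≠ k := fun h => hi (Fin.ext h)
    split_ifs with h <;> simp only [Fin.lt_def] at h <;> omega⟩

theorem indexAfterRemoving_injective {n : ℕ} (k i l : Fin (n + 1)) (hi : i ≠ k) (hl : l ≠ k)
    (h : indexAfterRemoving k i hi = indexAfterRemoving k l hl) : i = l := by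
  have h3 : (i : ℕ) ≠ k := fun h => hi (Fin.ext h)
  have h4 : (l : ℕ) ≠ k := fun h => hl (Fin.ext h)
  simp only [indexAfterRemoving, Fin.mk.injEq, Fin.lt_def] at h
  apply Fin.ext
  split_ifs at h <;> omega

/-- The map on nodes that identifies node `k` with node `j`: the index `k` disappears, and node `k`
is sent to the new index of `j`. -/
def identifyNode {n : ℕ} (j k : Fin (n + 1)) (hjk : j ≠ k) (i : Fin (n + 1)) : Fin n :=
  if hi : i = k then indexAfterRemoving k j hjk else indexAfterRemoving k i hi

/-- Contraction of a network on the distinct nodes `j` and `k`: all branches with endpoints `j` and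
`k` are deleted, and every other branch has its endpoints carried along the identification of
`k` with `j`. -/
def ElectricalNetwork.contract {K B : Type*} {n : ℕ} (N : ElectricalNetwork K (Fin (n + 1)) B)
    (j k : Fin (n + 1)) (hjk : j ≠ k) :
    ElectricalNetwork K (Fin n) {b : B // ¬ N.Joins b j k} where
  src b := identifyNode j k hjk (N.src b)
  tgt b := identifyNode j k hjk (N.tgt b)
  adm b := N.adm b
  src_ne_tgt := by
    rintro ⟨b, hb⟩ h
    have hne := N.src_ne_tgt b
    simp only [identifyNode] at h
    split_ifs at h with h1 h2 h2
    · exact hne (h1.trans h2.symm)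
    · exact hb (Or.inr ⟨h1, (indexAfterRemoving_injective _ _ _ _ _ h).symm⟩)
    · exact hb (Or.inl ⟨indexAfterRemoving_injective _ _ _ _ _ h, h2⟩)
    · exact hne (indexAfterRemoving_injective _ _ _ _ _ h)

section Cofactors

variable {K : Type*} [Field K]

/-- The first cofactor `C_{a,b}(A) = (-1)^(a+b) det A_{(a,b)}`.  Here indices start from `0`;
passing to indices from `1` changes `a + b` by `2`, hence not the sign. -/
def firstCofactor {n : ℕ} (A : Matrix (Fin (n + 1)) (Fin (n + 1)) K) (a b : Fin (n + 1)) : K :=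
  (-1) ^ ((a : ℕ) + (b : ℕ)) * (A.submatrix a.succAbove b.succAbove).det

/-- `σ(a, b) = a + b - 1` if `a < b`, and `a + b` otherwise. -/
def cofactorSigma (a b : ℕ) : ℕ := if a < b then a + b - 1 else a + b

/-- The increasing enumeration of the indices other than the distinct indices `a` and `b`. -/
def indicesOmitting {n : ℕ} (a b : Fin n) (h : a ≠ b) : Fin (n - 2) ↪o Fin n :=
  Finset.orderEmbOfFin ({a, b}ᶜ : Finset (Fin n))
    (by rw [Finset.card_compl, Finset.card_pair h, Fintype.card_fin])

/-- The second cofactor `C_{ab,cd}(A)`, with row indices `a, b` and column indices `c, d`: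
it is `(-1)^(σ(a,b) + σ(c,d)) det A_{(ab,cd)}`, where `A_{(ab,cd)}` arises by deleting rows `a, b`
and columns `c, d`, and `σ` is evaluated at the indices counted from `1`.
By convention it is `0` when `a = b` or `c = d`. -/
def secondCofactor {n : ℕ} (A : Matrix (Fin n) (Fin n) K) (a b c d : Fin n) : K :=
  if h : a ≠ b ∧ c ≠ d then
    (-1) ^ (cofactorSigma ((a : ℕ) + 1) ((b : ℕ) + 1) + cofactorSigma ((c : ℕ) + 1) ((d : ℕ) + 1)) *
      (A.submatrix (indicesOmitting a b h.1) (indicesOmitting c d h.2)).det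
  else 0

/-- The common value `c(A)` of the first cofactors of an admittance matrix, read off at the first
row and first column. -/
def commonCofactor {n : ℕ} (A : Matrix (Fin (n + 1)) (Fin (n + 1)) K) : K :=
  firstCofactor A 0 0

/-- The transfer impedance between the node pairs `(a, b)` and `(c, d)`. -/
def transferImpedance {n : ℕ} (A : Matrix (Fin (n + 1)) (Fin (n + 1)) K)
    (a b c d : Fin (n + 1)) : K :=
  secondCofactor A a b c d / commonCofactor A

/-- The driving-point impedance (self-impedance) of the node pair `(a, b)`. -/
def selfImpedance {n : ℕ} (A : Matrix (Fin (n + 1)) (Fin (n + 1)) K) (a b : Fin (n + 1)) : K :=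
  transferImpedance A a b a b

end Cofactors

/-! ### Cofactors of matrices with zero row sums -/

section CofactorTheory

open Matrix

variable {K : Type*} [Field K]

/-! Ground the network at node `k`: let `M` be `Y` without row and column `k`, and `G` its adjugate.
Since `Y` is symmetric with zero row sums, `c(Y) = det M`, and every second cofactor of `Y` is a
signed sum of grounded ones `C_{xk,yk}(Y) = G x' y'` (`secondCofactor_ground`,
`secondCofactor_succAbove`). With `u = e_{p'} - e_{q'}` and `v = e_{r'} - e_{s'}`, this makes
`C_{pq,rs}(Y) = uᵀGv`, `C_{pq,jk}(Y) = uᵀGe_{j'}` and `C_{jk,jk}(Y) = G j' j'`. Contraction changes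
`M` only in row and column `j'`. Grounding `Y⁻` at `j'` therefore expresses its second cofactors by
those of `M`, which Jacobi's identity (`det_mul_secondCofactor`) turns into 2×2 minors of `G`.
Expanding bilinearly gives the formula. Also `c(Y⁻) = G j' j' = C_{jk,jk}(Y)`, so dividing by it
yields the impedance formulas. -/

theorem firstCofactor_eq_adjugate {n : ℕ} (A : Matrix (Fin (n + 1)) (Fin (n + 1)) K)
    (a b : Fin (n + 1)) : firstCofactor A a b = A.adjugate b a := by
  rw [adjugate_fin_succ_eq_det_submatrix, firstCofactor]

theorem det_eq_zero_of_row_sums {V : Type*} [Fintype V] [DecidableEq V] [Nonempty V]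
    (A : Matrix V V K) (h : ∀ i, ∑ l, A i l = 0) : A.det = 0 := by
  refine exists_mulVec_eq_zero_iff.mp ⟨1, one_ne_zero, ?_⟩
  ext i
  simpa [mulVec, dotProduct] using h i

/-- Replacing row `a` by `e_b - e_c` keeps all row sums zero, so the determinant vanishes; linearity
in that row splits it into the two entries. -/
theorem adjugate_apply_eq_of_row_sums {V : Type*} [Fintype V] [DecidableEq V]
    (A : Matrix V V K) (h : ∀ i, ∑ l, A i l = 0) (a b c : V) :
    A.adjugate b a = A.adjugate c a := by
  have : Nonempty V := ⟨a⟩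
  have key : (A.updateRow a (Pi.single b 1 + (-1 : K) • Pi.single c 1)).det = 0 := by
    refine det_eq_zero_of_row_sums _ fun i => ?_
    by_cases hi : i = a
    · subst hi
      simp [Finset.sum_add_distrib]
    · simpa [updateRow_ne hi] using h i
  rw [det_updateRow_add, det_updateRow_smul] at key
  rw [adjugate_apply, adjugate_apply]
  linear_combination key

theorem firstCofactor_eq_commonCofactor {n : ℕ} (A : Matrix (Fin (n + 1)) (Fin (n + 1)) K)
    (hA : A.IsSymm) (h : ∀ i, ∑ l, A i l = 0) (a b : Fin (n + 1)) :
    firstCofactor A a b = commonCofactor A := by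
  have hs := fun x y => hA.adjugate.apply x y
  rw [commonCofactor, firstCofactor_eq_adjugate, firstCofactor_eq_adjugate,
    adjugate_apply_eq_of_row_sums A h a b 0, ← hs, adjugate_apply_eq_of_row_sums A h 0 a 0]

theorem commonCofactor_eq_det {n : ℕ} (A : Matrix (Fin (n + 1)) (Fin (n + 1)) K)
    (hA : A.IsSymm) (h : ∀ i, ∑ l, A i l = 0) (k : Fin (n + 1)) :
    commonCofactor A = (A.submatrix k.succAbove k.succAbove).det := by
  rw [← firstCofactor_eq_commonCofactor A hA h k k, firstCofactor, Even.neg_one_pow ⟨_, rfl⟩,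
    one_mul]

theorem indicesOmitting_ne {n : ℕ} (a b : Fin n) (h : a ≠ b) (i : Fin (n - 2)) :
    indicesOmitting a b h i ≠ a ∧ indicesOmitting a b h i ≠ b := by
  have := Finset.orderEmbOfFin_mem ({a, b}ᶜ : Finset (Fin n))
    (by rw [Finset.card_compl, Finset.card_pair h, Fintype.card_fin]) i
  rw [Finset.mem_compl, Finset.mem_insert, Finset.mem_singleton, not_or] at this
  exact this

theorem secondCofactor_congr {n : ℕ} (A A' : Matrix (Fin n) (Fin n) K) (a b c d : Fin n)
    (h : ∀ i l, i ≠ a → i ≠ b → l ≠ c → l ≠ d → A i l = A' i l) :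
    secondCofactor A a b c d = secondCofactor A' a b c d := by
  unfold secondCofactor
  split_ifs with hn
  · congr 2
    ext i l
    exact h _ _ (indicesOmitting_ne _ _ _ _).1 (indicesOmitting_ne _ _ _ _).2
      (indicesOmitting_ne _ _ _ _).1 (indicesOmitting_ne _ _ _ _).2
  · rfl

theorem secondCofactor_transpose {n : ℕ} (A : Matrix (Fin n) (Fin n) K) (a b c d : Fin n) :
    secondCofactor Aᵀ a b c d = secondCofactor A c d a b := by
  unfold secondCofactor
  by_cases h : a ≠ b ∧ c ≠ d
  · rw [dif_pos h, dif_pos h.symm, ← transpose_submatrix, det_transpose,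
      add_comm (cofactorSigma ((a : ℕ) + 1) _)]
  · rw [dif_neg h, dif_neg fun h' => h h'.symm]

theorem indicesOmitting_succAbove {n : ℕ} (a : Fin (n + 2)) (b : Fin (n + 1))
    (h : a ≠ a.succAbove b) (i : Fin n) :
    indicesOmitting a (a.succAbove b) h i = a.succAbove (b.succAbove i) := by
  have := Finset.orderEmbOfFin_unique (s := ({a, a.succAbove b}ᶜ : Finset (Fin (n + 2))))
    (k := n) (f := fun i => a.succAbove (b.succAbove i))
    (by rw [Finset.card_compl, Finset.card_pair h, Fintype.card_fin]; rfl)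
    (fun x => by simp [Fin.succAbove_ne])
    ((Fin.strictMono_succAbove a).comp (Fin.strictMono_succAbove b))
  exact (congrFun this i).symm

/-- The case split in `σ` undoes the shift made by `succAbove`: the exponent is `a + b + 2` either
way, so the sign is that of two successive Laplace expansions. -/
theorem neg_one_pow_cofactorSigma {n : ℕ} (a : Fin (n + 2)) (b : Fin (n + 1)) :
    (-1 : K) ^ cofactorSigma ((a : ℕ) + 1) ((a.succAbove b : ℕ) + 1) =
      (-1) ^ ((a : ℕ) + (b : ℕ)) := by
  unfold cofactorSigma
  rcases lt_or_ge b.castSucc a with h | h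
  · rw [Fin.succAbove_of_castSucc_lt _ _ h]
    simp only [Fin.lt_def, Fin.val_castSucc] at h
    rw [if_neg (by simp; omega), Fin.val_castSucc]
    ring
  · rw [Fin.succAbove_of_le_castSucc _ _ h]
    simp only [Fin.le_def, Fin.val_castSucc] at h
    rw [if_pos (by simp; omega), Fin.val_succ,
      show (a : ℕ) + 1 + ((b : ℕ) + 1 + 1) - 1 = a + b + 2 by omega]
    ring

theorem det_updateRow_single {n : ℕ} (A : Matrix (Fin (n + 1)) (Fin (n + 1)) K)
    (a c : Fin (n + 1)) :
    (A.updateRow a (Pi.single c 1)).det =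
      (-1) ^ ((a : ℕ) + (c : ℕ)) * (A.submatrix a.succAbove c.succAbove).det := by
  rw [← adjugate_apply, adjugate_fin_succ_eq_det_submatrix]

theorem submatrix_updateRow_single_succAbove {n : ℕ} (A : Matrix (Fin (n + 1)) (Fin (n + 1)) K)
    (a c : Fin (n + 1)) (b d : Fin n) :
    (A.updateRow (a.succAbove b) (Pi.single (c.succAbove d) 1)).submatrix
        a.succAbove c.succAbove =
      (A.submatrix a.succAbove c.succAbove).updateRow b (Pi.single d 1) := by
  ext i l
  by_cases hi : i = b
  · subst hi
    simp [Pi.single_apply]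
  · simp [updateRow_apply, hi]

/-- The second cofactor is the determinant of the matrix in which the deleted rows are replaced by
the unit vectors of the deleted columns. -/
theorem secondCofactor_eq_det {n : ℕ} (A : Matrix (Fin n) (Fin n) K) (a b c d : Fin n)
    (hab : a ≠ b) :
    secondCofactor A a b c d =
      ((A.updateRow b (Pi.single d 1)).updateRow a (Pi.single c 1)).det := by
  by_cases hcd : c = d
  · subst hcd
    rw [secondCofactor, dif_neg (by simp), eq_comm]
    refine det_zero_of_row_eq hab ?_
    simp [updateRow_ne hab.symm]
  obtain _ | _ | n := n
  · exact a.elim0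
  · exact absurd (Fin.ext (by omega)) hab
  obtain ⟨b, rfl⟩ := Fin.exists_succAbove_eq hab.symm
  obtain ⟨d, rfl⟩ := Fin.exists_succAbove_eq (Ne.symm hcd)
  rw [det_updateRow_single, submatrix_updateRow_single_succAbove, det_updateRow_single, secondCofactor,
    dif_pos ⟨hab, hcd⟩, pow_add, neg_one_pow_cofactorSigma, neg_one_pow_cofactorSigma]
  have : (A.submatrix (indicesOmitting a (a.succAbove b) hab)
      (indicesOmitting c (c.succAbove d) hcd)).det =
      ((A.submatrix a.succAbove c.succAbove).submatrix b.succAbove d.succAbove).det := by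
    congr 1
    ext i l
    exact congrArg₂ A (indicesOmitting_succAbove a b hab i) (indicesOmitting_succAbove c d hcd l)
  rw [this]
  ring

/-- With rows `a, b` replaced by `e_c - e_g` and `e_d - e_g`, all row sums are still zero. Expanding
this vanishing determinant as an alternating bilinear form in the two rows gives the identity. -/
theorem secondCofactor_ground_columns {n : ℕ} (A : Matrix (Fin n) (Fin n) K)
    (h : ∀ i, ∑ l, A i l = 0) (a b c d g : Fin n) :
    secondCofactor A a b c d = secondCofactor A a b c g - secondCofactor A a b d g := by
  by_cases hab : a = b
  · simp [secondCofactor, hab]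
  have : Nonempty (Fin n) := ⟨a⟩
  let F : (Fin n → K) → (Fin n → K) → K := fun u v => ((A.updateRow b v).updateRow a u).det
  have hleft : ∀ u u' v (t : K), F (u + t • u') v = F u v + t * F u' v := fun u u' v t => by
    simp only [F, det_updateRow_add, det_updateRow_smul]
  have hright : ∀ u v v' (t : K), F u (v + t • v') = F u v + t * F u v' := fun u v v' t => by
    simp only [F, updateRow_comm A (Ne.symm hab), det_updateRow_add, det_updateRow_smul]
  have halt : ∀ u, F u u = 0 := fun u =>
    det_zero_of_row_eq hab (by simp [updateRow_ne (Ne.symm hab)])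
  have key : F (Pi.single c 1 + (-1 : K) • Pi.single g 1)
      (Pi.single d 1 + (-1 : K) • Pi.single g 1) = 0 := by
    refine det_eq_zero_of_row_sums _ fun i => ?_
    by_cases hi : i = a
    · subst hi
      simp [Finset.sum_add_distrib]
    by_cases hi' : i = b
    · subst hi'
      simp [updateRow_ne hi, Finset.sum_add_distrib]
    · simpa [updateRow_ne hi, updateRow_ne hi'] using h i
  -- Polarization: `F(e_d + e_g, e_d + e_g) = 0` gives the antisymmetry of `F` needed to swap `e_g`
  -- and `e_d`.
  have hdg := halt (Pi.single d 1 + (1 : K) • Pi.single g 1)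
  rw [hleft, hright, hright, halt, halt] at hdg
  rw [hleft, hright, hright, halt] at key
  simp only [secondCofactor_eq_det _ _ _ _ _ hab]
  change F _ _ = F _ _ - F _ _
  linear_combination key + hdg

theorem secondCofactor_ground_rows {n : ℕ} (A : Matrix (Fin n) (Fin n) K)
    (h : ∀ l, ∑ i, A i l = 0) (a b c d g : Fin n) :
    secondCofactor A a b c d = secondCofactor A a g c d - secondCofactor A b g c d := by
  simp only [← secondCofactor_transpose A]
  exact secondCofactor_ground_columns Aᵀ h c d a b g

theorem secondCofactor_ground {n : ℕ} (A : Matrix (Fin n) (Fin n) K) (hA : A.IsSymm)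
    (h : ∀ i, ∑ l, A i l = 0) (a b c d g : Fin n) :
    secondCofactor A a b c d = secondCofactor A a g c g - secondCofactor A a g d g -
      secondCofactor A b g c g + secondCofactor A b g d g := by
  have h' : ∀ l, ∑ i, A i l = 0 := fun l => by
    simpa only [hA.apply] using h l
  rw [secondCofactor_ground_rows A h' a b c d g, secondCofactor_ground_columns A h a g c d g,
    secondCofactor_ground_columns A h b g c d g]
  ring

/-- Row `k` becomes `e_k`; expanding along it strips row and column `k` with sign `+1`. -/
theorem secondCofactor_succAbove {n : ℕ} (A : Matrix (Fin (n + 1)) (Fin (n + 1)) K)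
    (k : Fin (n + 1)) (a c : Fin n) :
    secondCofactor A (k.succAbove a) k (k.succAbove c) k =
      (A.submatrix k.succAbove k.succAbove).adjugate c a := by
  rw [secondCofactor_eq_det _ _ _ _ _ (Fin.succAbove_ne k a),
    updateRow_comm _ (Fin.succAbove_ne k a).symm, det_updateRow_single,
    submatrix_updateRow_single_succAbove, adjugate_apply, Even.neg_one_pow ⟨_, rfl⟩, one_mul]

/-- The matrix is a rank-two perturbation `1 + UW` of the identity, and `det (1 + UW) = det (1 +
WU)` reduces to size two. -/
theorem det_one_updateRow_updateRow {V : Type*} [Fintype V] [DecidableEq V] (a b : V) (hab : a ≠ b)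
    (x y : V → K) :
    (((1 : Matrix V V K).updateRow b y).updateRow a x).det = x a * y b - x b * y a := by
  let U : Matrix V (Fin 2) K := of fun i => ![(1 : Matrix V V K) i a, (1 : Matrix V V K) i b]
  let W : Matrix (Fin 2) V K := of fun t l =>
    ![x l - (1 : Matrix V V K) a l, y l - (1 : Matrix V V K) b l] t
  have h : ((1 : Matrix V V K).updateRow b y).updateRow a x = 1 + U * W := by
    ext i l
    simp only [U, W, Matrix.add_apply, mul_apply, Fin.sum_univ_two, of_apply, cons_val_zero,
      cons_val_one]
    by_cases hi : i = a
    · subst hi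
      simp [hab]
    by_cases hi' : i = b
    · subst hi'
      simp [hi]
    · simp [hi, hi']
  rw [h, det_one_add_mul_comm, det_fin_two]
  simp only [U, W, Matrix.add_apply, mul_apply, of_apply, cons_val_zero, cons_val_one]
  simp [one_apply, hab, hab.symm]

/-- Jacobi's identity for the minors of order two of the adjugate. -/
theorem det_mul_secondCofactor {n : ℕ} (M : Matrix (Fin n) (Fin n) K) (hM : M.det ≠ 0)
    (a b c d : Fin n) :
    M.det * secondCofactor M a b c d =
      M.adjugate c a * M.adjugate d b - M.adjugate c b * M.adjugate d a := by
  by_cases hab : a = b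
  · simp [secondCofactor, hab]
  have hu : IsUnit M.det := isUnit_iff_ne_zero.mpr hM
  have hadj : ∀ i l, M.adjugate i l = M.det * M⁻¹ i l := fun i l => by
    rw [inv_def, Ring.inverse_eq_inv', Matrix.smul_apply, smul_eq_mul, mul_inv_cancel_left₀ hM]
  -- Right multiplication by `M⁻¹` turns the untouched rows into unit vectors and the inserted
  -- `e_c`, `e_d` into rows `c`, `d` of `M⁻¹`.
  have key : ((M.updateRow b (Pi.single d 1)).updateRow a (Pi.single c 1)) * M⁻¹ =
      ((1 : Matrix (Fin n) (Fin n) K).updateRow b (M⁻¹ d)).updateRow a (M⁻¹ c) := by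
    rw [updateRow_mul, updateRow_mul, mul_nonsing_inv _ hu]
    congr 2 <;> ext <;> simp
  have hdet := congrArg det key
  rw [det_mul, det_one_updateRow_updateRow _ _ hab, det_nonsing_inv, Ring.inverse_eq_inv',
    ← secondCofactor_eq_det _ _ _ _ _ hab, mul_inv_eq_iff_eq_mul₀ hM] at hdet
  rw [hdet, hadj, hadj, hadj, hadj]
  ring

end CofactorTheory

/-! ### Admittance matrices -/

namespace ElectricalNetwork

variable {K V B : Type*} [Field K] [DecidableEq V] [Fintype B]

/-- Each branch contributes its admittance times `(e_src - e_tgt)(e_src - e_tgt)ᵀ`; symmetry and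
zero row sums are then immediate. -/
theorem admittanceMatrix_apply (N : ElectricalNetwork K V B) (i l : V) :
    N.admittanceMatrix i l =
      ∑ b, N.adm b * (((if N.src b = i then 1 else 0) - (if N.tgt b = i then 1 else 0)) *
        ((if N.src b = l then 1 else 0) - (if N.tgt b = l then 1 else 0))) := by
  simp only [admittanceMatrix, Matrix.of_apply]
  split_ifs with h
  · subst h
    rw [Finset.sum_filter]
    refine Finset.sum_congr rfl fun b _ => ?_
    have := N.src_ne_tgt b
    by_cases h1 : N.src b = i <;> by_cases h2 : N.tgt b = i <;> simp_all [Incident]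
  · rw [Finset.sum_filter, ← Finset.sum_neg_distrib]
    refine Finset.sum_congr rfl fun b _ => ?_
    have := N.src_ne_tgt b
    by_cases h1 : N.src b = i <;> by_cases h2 : N.tgt b = i <;> by_cases h3 : N.src b = l <;>
      by_cases h4 : N.tgt b = l <;> simp_all [Joins]

theorem admittanceMatrix_isSymm (N : ElectricalNetwork K V B) : N.admittanceMatrix.IsSymm :=
  Matrix.IsSymm.ext fun i l => by
    rw [admittanceMatrix_apply, admittanceMatrix_apply]
    exact Finset.sum_congr rfl fun b _ => by ring

theorem sum_admittanceMatrix [Fintype V] (N : ElectricalNetwork K V B) (i : V) :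
    ∑ l, N.admittanceMatrix i l = 0 := by
  simp only [admittanceMatrix_apply]
  rw [Finset.sum_comm]
  refine Finset.sum_eq_zero fun b _ => ?_
  rw [← Finset.mul_sum, ← Finset.mul_sum]
  simp

end ElectricalNetwork

/-! ### Contraction and the main theorem -/

theorem succAbove_indexAfterRemoving {n : ℕ} (k i : Fin (n + 1)) (hi : i ≠ k) :
    k.succAbove (indexAfterRemoving k i hi) = i := by
  have h3 : (i : ℕ) ≠ k := fun h => hi (Fin.ext h)
  apply Fin.ext
  simp only [Fin.succAbove, indexAfterRemoving, Fin.lt_def, Fin.val_castSucc]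
  split_ifs <;> simp <;> omega

theorem identifyNode_eq_iff {n : ℕ} (j k : Fin (n + 1)) (hjk : j ≠ k) (x : Fin (n + 1)) (i : Fin n)
    (hi : i ≠ indexAfterRemoving k j hjk) :
    identifyNode j k hjk x = i ↔ x = k.succAbove i := by
  unfold identifyNode
  split_ifs with h
  · exact ⟨fun h' => absurd h'.symm hi, fun h' => absurd (h'.symm.trans h) (Fin.succAbove_ne k i)⟩
  · rw [← (Fin.succAbove_right_injective (p := k)).eq_iff, succAbove_indexAfterRemoving]

theorem ElectricalNetwork.contract_admittanceMatrix_apply {K B : Type*} [Field K] [Fintype B]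
    {n : ℕ} (N : ElectricalNetwork K (Fin (n + 1)) B) (j k : Fin (n + 1)) (hjk : j ≠ k)
    (i l : Fin n) (hi : i ≠ indexAfterRemoving k j hjk) (hl : l ≠ indexAfterRemoving k j hjk) :
    (N.contract j k hjk).admittanceMatrix i l =
      N.admittanceMatrix (k.succAbove i) (k.succAbove l) := by
  have hij : j ≠ k.succAbove i := fun h =>
    hi (Fin.succAbove_right_injective (p := k) (by rw [succAbove_indexAfterRemoving, h]))
  have hik := Fin.succAbove_ne k i
  rw [admittanceMatrix_apply, admittanceMatrix_apply]
  simp only [contract, identifyNode_eq_iff j k hjk _ _ hi, identifyNode_eq_iff j k hjk _ _ hl]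
  -- The deleted branches contribute nothing here, since neither of their ends `j`, `k` is
  -- `k.succAbove i`.
  rw [← Fintype.sum_subtype_add_sum_subtype (fun b => N.Joins b j k), eq_comm, add_eq_right]
  refine Finset.sum_eq_zero fun b _ => ?_
  obtain ⟨h1, h2⟩ | ⟨h1, h2⟩ := b.2 <;> simp [h1, h2, hij, hik.symm]

theorem mainTheorem4 {K B : Type*} [Field K] [Fintype B] {n : ℕ}
    (N : ElectricalNetwork K (Fin (n + 2)) B) (j k : Fin (n + 2)) (hjk : j ≠ k)
    (Y : Matrix (Fin (n + 2)) (Fin (n + 2)) K) (hY : Y = N.admittanceMatrix)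
    (Ym : Matrix (Fin (n + 1)) (Fin (n + 1)) K) (hYm : Ym = (N.contract j k hjk).admittanceMatrix) :
    (∀ a b : Fin (n + 2), firstCofactor Y a b = commonCofactor Y) ∧
    (commonCofactor Y ≠ 0 →
    (∀ (p q r s : Fin (n + 2)) (hp : p ≠ k) (hq : q ≠ k) (hr : r ≠ k) (hs : s ≠ k),
      secondCofactor Ym (indexAfterRemoving k p hp) (indexAfterRemoving k q hq)
          (indexAfterRemoving k r hr) (indexAfterRemoving k s hs) =
        (secondCofactor Y p q r s * secondCofactor Y j k j k -
          secondCofactor Y p q j k * secondCofactor Y r s j k) / commonCofactor Y) ∧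
    (selfImpedance Y j k ≠ 0 →
      (∀ a b, firstCofactor Ym a b = commonCofactor Ym) ∧
      commonCofactor Ym ≠ 0 ∧
      (∀ (p q r s : Fin (n + 2)) (hp : p ≠ k) (hq : q ≠ k) (hr : r ≠ k) (hs : s ≠ k),
        transferImpedance Ym (indexAfterRemoving k p hp) (indexAfterRemoving k q hq)
            (indexAfterRemoving k r hr) (indexAfterRemoving k s hs) =
          transferImpedance Y p q r s -
            transferImpedance Y p q j k * (transferImpedance Y r s j k / selfImpedance Y j k)) ∧
      (∀ (p q : Fin (n + 2)) (hp : p ≠ k) (hq : q ≠ k),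
        selfImpedance Ym (indexAfterRemoving k p hp) (indexAfterRemoving k q hq) =
          selfImpedance Y p q - transferImpedance Y p q j k ^ 2 / selfImpedance Y j k))) := by
  have hYs : Y.IsSymm := hY ▸ N.admittanceMatrix_isSymm
  have hY0 : ∀ i, ∑ l, Y i l = 0 := hY ▸ N.sum_admittanceMatrix
  have hYms : Ym.IsSymm := hYm ▸ (N.contract j k hjk).admittanceMatrix_isSymm
  have hYm0 : ∀ i, ∑ l, Ym i l = 0 := hYm ▸ (N.contract j k hjk).sum_admittanceMatrix
  refine ⟨firstCofactor_eq_commonCofactor Y hYs hY0, fun hc => ?_⟩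
  set M := Y.submatrix k.succAbove k.succAbove with hM
  set j' := indexAfterRemoving k j hjk with hj'
  have hMs : ∀ x y, M.adjugate x y = M.adjugate y x := fun x y =>
    (hYs.submatrix k.succAbove).adjugate.apply y x
  have hYmM : ∀ i l, i ≠ j' → l ≠ j' → Ym i l = M i l := fun i l hi hl => by
    rw [hYm, N.contract_admittanceMatrix_apply j k hjk i l hi hl, hM, hY, Matrix.submatrix_apply]
  have hcM : commonCofactor Y = M.det := commonCofactor_eq_det Y hYs hY0 k
  have hMdet : M.det ≠ 0 := hcM ▸ hc
  have hkk : ∀ (x y : Fin (n + 2)) (hx : x ≠ k) (hy : y ≠ k), secondCofactor Y x k y k =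
      M.adjugate (indexAfterRemoving k x hx) (indexAfterRemoving k y hy) := fun x y hx hy => by
    rw [hMs, ← secondCofactor_succAbove, succAbove_indexAfterRemoving,
      succAbove_indexAfterRemoving]
  -- These terms arise on grounding `C_{xy,jk}`, whose last index is already the ground `k`.
  have hk0 : ∀ x y, secondCofactor Y x y k k = 0 := by
    simp [secondCofactor]
  -- Row and column `j'` are deleted, so `Ym` may be replaced by `M` before Jacobi's identity is
  -- applied.
  have hmm : ∀ a c : Fin (n + 1), M.det * secondCofactor Ym a j' c j' =
      M.adjugate a c * M.adjugate j' j' - M.adjugate a j' * M.adjugate c j' := fun a c => by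
    rw [secondCofactor_congr Ym M a j' c j' fun i l _ hi _ hl => hYmM i l hi hl,
      det_mul_secondCofactor M hMdet, hMs c a, hMs j' a]
    ring
  have hself : secondCofactor Y j k j k = M.adjugate j' j' := hkk j j hjk hjk
  have hcm : commonCofactor Ym = M.adjugate j' j' := by
    rw [commonCofactor_eq_det Ym hYms hYm0 j', ← firstCofactor_eq_adjugate, firstCofactor,
      Even.neg_one_pow ⟨_, rfl⟩, one_mul]
    congr 1
    ext i l
    exact hYmM _ _ (Fin.succAbove_ne _ _) (Fin.succAbove_ne _ _)
  have hmain : ∀ (p q r s : Fin (n + 2)) (hp : p ≠ k) (hq : q ≠ k) (hr : r ≠ k) (hs : s ≠ k),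
      secondCofactor Ym (indexAfterRemoving k p hp) (indexAfterRemoving k q hq)
          (indexAfterRemoving k r hr) (indexAfterRemoving k s hs) =
        (secondCofactor Y p q r s * secondCofactor Y j k j k -
          secondCofactor Y p q j k * secondCofactor Y r s j k) / commonCofactor Y := by
    intro p q r s hp hq hr hs
    -- Grounding `Ym` at `j'` and `Y` at `k` makes both sides polynomials in entries of
    -- `M.adjugate`.
    rw [eq_div_iff hc, hcM, mul_comm, secondCofactor_ground Ym hYms hYm0 _ _ _ _ j',
      mul_add, mul_sub, mul_sub, hmm, hmm, hmm, hmm, hself,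
      secondCofactor_ground Y hYs hY0 p q r s k, secondCofactor_ground Y hYs hY0 p q j k k,
      secondCofactor_ground Y hYs hY0 r s j k k]
    simp only [hkk _ _ hp hr, hkk _ _ hp hs, hkk _ _ hq hr, hkk _ _ hq hs, hkk _ _ hp hjk,
      hkk _ _ hq hjk, hkk _ _ hr hjk, hkk _ _ hs hjk, hk0, ← hj']
    ring
  refine ⟨hmain, fun hz => ?_⟩
  have hzc : secondCofactor Y j k j k ≠ 0 := fun h => hz (by
    rw [selfImpedance, transferImpedance, h, zero_div])
  have htrans : ∀ (p q r s : Fin (n + 2)) (hp : p ≠ k) (hq : q ≠ k) (hr : r ≠ k) (hs : s ≠ k),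
      transferImpedance Ym (indexAfterRemoving k p hp) (indexAfterRemoving k q hq)
          (indexAfterRemoving k r hr) (indexAfterRemoving k s hs) =
        transferImpedance Y p q r s -
          transferImpedance Y p q j k * (transferImpedance Y r s j k / selfImpedance Y j k) := by
    intro p q r s hp hq hr hs
    simp only [selfImpedance, transferImpedance, hmain p q r s hp hq hr hs]
    rw [hcm, ← hself]
    field_simp
  refine ⟨firstCofactor_eq_commonCofactor Ym hYms hYm0, by rwa [hcm, ← hself], htrans,
    fun p q hp hq => ?_⟩
  rw [selfImpedance, htrans p q p q hp hq hp hq, selfImpedance.eq_def Y p q]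
  ring
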